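/- **Theorem (Stability of error moments).** Consider $N$ agents partitioned into groups $\mathcal{G}_1,\dots,\mathcal{G}_G$. Agent $k$ has a cost $J_k:\mathbb{R}^M\to\mathbb{R}$ that is strictly convex and twice differentiable, with $\lambda_{k,L} I_M\le\nabla^2 J_k(w)\le\lambda_{k,U} I_M$ for all $w$, where $0\le\lambda_{k,L}\le\lambda_{k,U}<\infty$, and that is minimized at $w_k^o$. Agents of the same group have the same minimizer, and every group contains an agent $k$ with $\lambda_{k,L}>0$. Let $A=[a_{\ell k}]$ be an $N\times N$ matrix with $a_{\ell k}=0$ whenever $\ell,k$ lie in different groups, whose diagonal block $A_m=[a_{\ell k}]_{\ell,k\in\mathcal{G}_m}$ is, for every $m$, left-stochastic (nonnegative entries, columns summing to one) and primitive (some positive power has only positive entries). Starting from $\boldsymbol{w}_{k,-1}=0$, the agents run, for $i\ge 0$, the diffusion recursion $$\boldsymbol{\psi}_{k,i}=\boldsymbol{w}_{k,i-1}-\mu_k\,\widehat{\nabla J_k}(\boldsymbol{w}_{k,i-1}),\qquad \boldsymbol{w}_{k,i}=\sum_{\ell} a_{\ell k}\,\boldsymbol{\psi}_{\ell,i},$$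 with step-sizes $\mu_k>0$ and random gradient approximations $\widehat{\nabla J_k}$ (which may change with $i$). Write $\mathcal{W}=\mathrm{col}\{w_1,\dots,w_N\}$, $\mathcal{W}^o=\mathrm{col}\{w_1^o,\dots,w_N^o\}$, let $\mathcal{S}_i(\mathcal{W})=\mathrm{col}\{\widehat{\nabla J_k}(w_k)-\nabla J_k(w_k)\}_{k=1}^N$ be the gradient noise at iteration $i$, and let $(\mathbb{F}_i)_{i\ge -1}$ be a filtration such that, for every $i\ge0$ and every $\mathbb{F}_{i-1}$-measurable random vector $\boldsymbol{\mathcal{W}}$ with finite fourth moment, $\mathcal{S}_i(\boldsymbol{\mathcal{W}})$ is $\mathbb{F}_i$-measurable and, almost surely, $$\mathbb{E}[\mathcal{S}_i(\boldsymbol{\mathcal{W}})\mid\mathbb{F}_{i-1}]=0,\qquad \mathbb{E}[\|\mathcal{S}_i(\boldsymbol{\mathcal{W}})\|^4\mid\mathbb{F}_{i-1}]\le\alpha^2\|\mathcal{W}^o-\boldsymbol{\mathcal{W}}\|^4+\sigma_s^4,$$ where $\alpha,\sigma_s\ge0$ are constants. Let $\mu_{\max}=\max_k\mu_k$ and $\widetilde{\boldsymbol{\mathcal{W}}}_i=\mathcal{W}^o-\mathrm{col}\{\boldsymbol{w}_{1,i},\dots,\boldsymbol{w}_{N,i}\}$.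 Then for every $\rho>0$ there are constants $\mu_0>0$ and $C\ge0$ such that, for all step-sizes with $\mu_k\ge\rho\,\mu_{\max}$ for all $k$ and $\mu_{\max}\le\mu_0$, $$\limsup_{i\to\infty}\mathbb{E}\|\widetilde{\boldsymbol{\mathcal{W}}}_i\|^2\le C\mu_{\max},\qquad \limsup_{i\to\infty}\mathbb{E}\|\widetilde{\boldsymbol{\mathcal{W}}}_i\|^4\le C\mu_{\max}^2.$$ -/

import Mathlib

open MeasureTheory ProbabilityTheory Filter
open scoped Gradient ENNReal RealInnerProductSpace

namespace DiffusionNetwork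

/-- The parameter space `ℝ^M` with the Euclidean norm. -/
abbrev Vec (M : ℕ) : Type := EuclideanSpace ℝ (Fin M)

/-- Network vectors `col{w_1, …, w_N} ∈ ℝ^{NM}` with the Euclidean norm. -/
abbrev NetVec (N M : ℕ) : Type := PiLp 2 (fun _ : Fin N => Vec M)

/-- The block `A_m = [a_{ℓk}; ℓ, k ∈ 𝒢_m]` of the combination matrix, where `𝒢_m` is the set of
agents `k` with `grp k = m`. -/
def groupMatrix {N G : ℕ} (A : Matrix (Fin N) (Fin N) ℝ) (grp : Fin N → Fin G) (m : Fin G) :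
    Matrix {k : Fin N // grp k = m} {k : Fin N // grp k = m} ℝ :=
  A.submatrix Subtype.val Subtype.val

/-- Conditions on the combination coefficients `A ℓ k = a_{ℓk}`: agents combine only within their
group, and every group block is a primitive left-stochastic matrix (nonnegativity of the entries
is part of primitivity). -/
structure IsCombinationPolicy {N G : ℕ} (grp : Fin N → Fin G)
    (A : Matrix (Fin N) (Fin N) ℝ) : Prop where
  off_group : ∀ l k, grp l ≠ grp k → A l k = 0
  leftStochastic : ∀ k, ∑ l, A l k = 1
  primitive : ∀ m, (groupMatrix A grp m).IsPrimitive

/-- A combination matrix that is supported on the in-group neighborhoods of a graph (every agent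
being a neighbor of itself), with positive coefficients there and unit column sums, is a
combination policy as soon as every group is connected. -/
theorem IsCombinationPolicy.of_connected {N G : ℕ} (grp : Fin N → Fin G)
    (A : Matrix (Fin N) (Fin N) ℝ) (T : SimpleGraph (Fin N))
    (hT : ∀ m, (T.induce {k | grp k = m}).Connected)
    (hpos : ∀ l k, (l = k ∨ T.Adj l k) ∧ grp l = grp k → 0 < A l k)
    (hzero : ∀ l k, ¬ ((l = k ∨ T.Adj l k) ∧ grp l = grp k) → A l k = 0)
    (hsum : ∀ k, ∑ l, A l k = 1) : IsCombinationPolicy grp A := by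
  refine ⟨fun l k h => hzero l k fun h' => h h'.2, hsum, fun m => ?_⟩
  set B := groupMatrix A grp m with hB
  have hnn : ∀ l k, 0 ≤ B l k := fun l k => by
    by_cases h : ((l : Fin N) = k ∨ T.Adj l k) ∧ grp l = grp k
    · exact (hpos _ _ h).le
    · exact (hzero _ _ h).ge
  have hstep : ∀ (n : ℕ) l j k, 0 < (B ^ n) l j → 0 < B j k → 0 < (B ^ (n + 1)) l k := by
    intro n l j k h1 h2
    rw [pow_succ, Matrix.mul_apply]
    exact Finset.sum_pos' (fun x _ => mul_nonneg (Matrix.pow_apply_nonneg hnn n l x) (hnn x k))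
      ⟨j, Finset.mem_univ _, mul_pos h1 h2⟩
  have hself : ∀ k, 0 < B k k := fun k => hpos _ _ ⟨Or.inl rfl, rfl⟩
  have hmono : ∀ (n d : ℕ) l k, 0 < (B ^ n) l k → 0 < (B ^ (n + d)) l k := by
    intro n d l k h
    induction d with
    | zero => exact h
    | succ d ih => exact hstep (n + d) l k k ih (hself k)
  have hex : ∀ l k, ∃ n : ℕ, 0 < (B ^ n) l k := by
    intro l k
    have hr : Relation.ReflTransGen (T.induce {k | grp k = m}).Adj l k :=
      (SimpleGraph.reachable_iff_reflTransGen _ _).1 ((hT m).preconnected l k)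
    induction hr with
    | refl => exact ⟨0, by simp⟩
    | @tail b c _ hbc ih =>
      obtain ⟨n, hn⟩ := ih
      have hb : grp b = m := b.2
      have hc : grp c = m := c.2
      exact ⟨n + 1, hstep n l b c hn (hpos _ _ ⟨Or.inr hbc, hb.trans hc.symm⟩)⟩
  choose f hf using hex
  refine ⟨hnn, (∑ l, ∑ k, f l k) + 1, Nat.succ_pos _, fun l k => ?_⟩
  have h1 : f l k ≤ ∑ k', f l k' :=
    Finset.single_le_sum (f := fun k' => f l k') (fun _ _ => Nat.zero_le _) (Finset.mem_univ k)
  have h2 : ∑ k', f l k' ≤ ∑ l', ∑ k', f l' k' :=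
    Finset.single_le_sum (f := fun l' => ∑ k', f l' k') (fun _ _ => Nat.zero_le _)
      (Finset.mem_univ l)
  obtain ⟨d, hd⟩ := Nat.exists_eq_add_of_le (h1.trans (h2.trans (Nat.le_succ _)))
  rw [Nat.succ_eq_add_one] at hd
  rw [hd]
  exact hmono _ d l k (hf l k)

/-- The Hessian of `f` at `w`, as the derivative of the gradient field. -/
noncomputable def hessian {M : ℕ} (f : Vec M → ℝ) (w : Vec M) : Vec M →L[ℝ] Vec M :=
  fderiv ℝ (∇ f) w

/-- Conditions on the individual costs `J k`, their minimizers `wo k`, and the bounds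
`lamL k • I ≤ ∇²J_k ≤ lamU k • I`. Agents of the same group belong to the same cluster, that is,
their costs share the minimizer. -/
structure IsCostFamily {N M G : ℕ} (grp : Fin N → Fin G) (J : Fin N → Vec M → ℝ)
    (wo : NetVec N M) (lamL lamU : Fin N → ℝ) : Prop where
  strictConvex : ∀ k, StrictConvexOn ℝ Set.univ (J k)
  differentiable : ∀ k, Differentiable ℝ (J k)
  differentiable_gradient : ∀ k, Differentiable ℝ (∇ (J k))
  minimizer : ∀ k, IsMinOn (J k) Set.univ (wo k)
  common_minimizer : ∀ k l, grp k = grp l → wo k = wo l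
  lamL_nonneg : ∀ k, 0 ≤ lamL k
  hessian_lower : ∀ k w v, lamL k * ‖v‖ ^ 2 ≤ ⟪v, hessian (J k) w v⟫
  hessian_upper : ∀ k w v, ⟪v, hessian (J k) w v⟫ ≤ lamU k * ‖v‖ ^ 2
  strong : ∀ m, ∃ k, grp k = m ∧ 0 < lamL k

/-- The network gradient `∇J(W) = col{∇J_1(w_1), …, ∇J_N(w_N)}`. -/
noncomputable def netGrad {N M : ℕ} (J : Fin N → Vec M → ℝ) (W : NetVec N M) : NetVec N M :=
  WithLp.toLp 2 fun k => ∇ (J k) (W k)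

/-- The network stochastic gradient at `W`, where `g k w` is the approximation of `∇J_k(w)`
available to agent `k`. -/
noncomputable def netApproxGrad {N M : ℕ} (g : Fin N → Vec M → Vec M) (W : NetVec N M) :
    NetVec N M :=
  WithLp.toLp 2 fun k => g k (W k)

/-- The network gradient noise: stochastic gradient minus true gradient. -/
noncomputable def gradNoise {N M : ℕ} (J : Fin N → Vec M → ℝ) (g : Fin N → Vec M → Vec M)
    (W : NetVec N M) : NetVec N M :=
  netApproxGrad g W - netGrad J W

/-- Conditions on the gradient noise. Here `gHat i ω k w` is the approximation of `∇J_k(w)` that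
agent `k` uses in the step from the `i`-th to the `(i+1)`-st iterate, and `ℱ i` is the information
available at the `i`-th iterate. For every `ℱ i`-measurable `W` with finite fourth moment, the
noise at `W` is part of the information at `i + 1`, has zero conditional mean given `ℱ i`, and has
conditional fourth moment at most `α² ‖W° - W‖⁴ + σ⁴`. Integrability of the fourth power is implied
by that bound for the conditional expectation of nonnegative variables; it is listed because
Mathlib's conditional expectation is zero on non-integrable functions. -/
structure IsGradientNoise {N M : ℕ} {Ω : Type*} {mΩ : MeasurableSpace Ω} (P : Measure Ω)
    (ℱ : Filtration ℕ mΩ) (J : Fin N → Vec M → ℝ) (wo : NetVec N M)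
    (gHat : ℕ → Ω → Fin N → Vec M → Vec M) (α σ : ℝ) : Prop where
  adapted : ∀ (i : ℕ) (W : Ω → NetVec N M), StronglyMeasurable[ℱ i] W → MemLp W 4 P →
    StronglyMeasurable[ℱ (i + 1)] fun ω => gradNoise J (gHat i ω) (W ω)
  integrable : ∀ (i : ℕ) (W : Ω → NetVec N M), StronglyMeasurable[ℱ i] W → MemLp W 4 P →
    Integrable (fun ω => ‖gradNoise J (gHat i ω) (W ω)‖ ^ 4) P
  martingaleDifference : ∀ (i : ℕ) (W : Ω → NetVec N M), StronglyMeasurable[ℱ i] W →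
    MemLp W 4 P → P[fun ω => gradNoise J (gHat i ω) (W ω) | ℱ i] =ᵐ[P] 0
  fourthMoment : ∀ (i : ℕ) (W : Ω → NetVec N M), StronglyMeasurable[ℱ i] W → MemLp W 4 P →
    P[fun ω => ‖gradNoise J (gHat i ω) (W ω)‖ ^ 4 | ℱ i] ≤ᵐ[P]
      fun ω => α ^ 2 * ‖wo - W ω‖ ^ 4 + σ ^ 4

/-- One adapt-then-combine step with step-sizes `μ`:
`ψ_ℓ = w_ℓ - μ_ℓ ĝ_ℓ(w_ℓ)` and then `w_k' = ∑_ℓ a_{ℓk} ψ_ℓ`. -/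
noncomputable def atcStep {N M : ℕ} (A : Matrix (Fin N) (Fin N) ℝ) (μ : Fin N → ℝ)
    (g : Fin N → Vec M → Vec M) (W : NetVec N M) : NetVec N M :=
  WithLp.toLp 2 fun k => ∑ l, A l k • (W l - μ l • g l (W l))

/-- The network iterates of the diffusion strategy, started at zero. -/
noncomputable def iterate {N M : ℕ} {Ω : Type*} (A : Matrix (Fin N) (Fin N) ℝ) (μ : Fin N → ℝ)
    (gHat : ℕ → Ω → Fin N → Vec M → Vec M) : ℕ → Ω → NetVec N M
  | 0 => fun _ => 0
  | i + 1 => fun ω => atcStep A μ (gHat i ω) (iterate A μ gHat i ω)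

/-- The network error vector `W° - W_i`. -/
noncomputable def netError {N M : ℕ} {Ω : Type*} (A : Matrix (Fin N) (Fin N) ℝ) (μ : Fin N → ℝ)
    (gHat : ℕ → Ω → Fin N → Vec M → Vec M) (wo : NetVec N M) (i : ℕ) (ω : Ω) : NetVec N M :=
  wo - iterate A μ gHat i ω

/-- The largest step-size. -/
noncomputable def muMax {N : ℕ} (μ : Fin N → ℝ) : ℝ := ⨆ k, μ k

end DiffusionNetwork

/-!
The agents contract the error at different rates: an agent with `λ_{k,L} = 0` does not contract it
at all. With `p` the Perron vector of the group blocks and `d_k = 2 ρ λ_{k,L}`, the Fredholm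
alternative solves `A r = r + (d - c) p`, where `c` is the `p`-average of `d` over each group. In
the norm weighted by `q = p + u r`, `u = μ_max`, the combination step then passes the contraction
around each group to first order in `u`, and every agent contracts at the same positive rate
`1 - κ u`. The gradient noise has conditional mean zero, so the weighted fourth moment obeys
`m_{i+1} ≤ (1 - κ u / 2) m_i + O(u³)`, whence its limsup is `O(u²)`; the second moment follows from
Lyapunov's inequality.
-/

namespace DiffusionNetwork

open Matrix

section StochasticMatrices

lemma exists_mulVec_eq_of_forall_vecMul_eq_zero {K m n : Type*} [Field K] [Fintype m] [Fintype n]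
    {M : Matrix m n K} {b : m → K}
    (hb : ∀ x, x ᵥ* M = 0 → x ⬝ᵥ b = 0) : ∃ r, M *ᵥ r = b := by
  classical
  by_contra hM
  obtain ⟨f, hfb, hfM⟩ := Submodule.exists_le_ker_of_notMem (p := LinearMap.range M.mulVecLin) hM
  obtain ⟨x, rfl⟩ := (dotProductEquiv K m).surjective f
  refine hfb (hb x (dotProduct_eq_zero _ fun v => ?_))
  rw [← dotProduct_mulVec]
  exact hfM ⟨v, rfl⟩

lemma pow_mulVec_eq_self {R n : Type*} [Semiring R] [Fintype n] [DecidableEq n]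
    {B : Matrix n n R} {v : n → R} (hv : B *ᵥ v = v) (k : ℕ) : B ^ k *ᵥ v = v := by
  induction k with
  | zero => rw [pow_zero, one_mulVec]
  | succ k ih => rw [pow_succ, ← mulVec_mulVec, hv, ih]

variable {R n : Type*} [Field R] [LinearOrder R] [IsStrictOrderedRing R] [Fintype n]
  {B : Matrix n n R} {v : n → R}

lemma pos_of_mulVec_eq_self (hB : B.IsIrreducible) (hv : B *ᵥ v = v) (hv0 : ∀ i, 0 ≤ v i)
    {j : n} (hj : 0 < v j) (i : n) : 0 < v i := by
  classical
  obtain ⟨k, -, hk⟩ := (isIrreducible_iff_exists_pow_pos hB.nonneg).1 hB i j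
  rw [← congrFun (pow_mulVec_eq_self hv k) i]
  exact Finset.sum_pos' (fun l _ => mul_nonneg (pow_apply_nonneg hB.nonneg k i l) (hv0 l))
    ⟨j, Finset.mem_univ j, mul_pos hk hj⟩

variable [DecidableEq n]

lemma mulVec_abs_eq_self (hB : B ∈ colStochastic R n) (hv : B *ᵥ v = v) : B *ᵥ |v| = |v| := by
  have abs_le : ∀ i ∈ Finset.univ, |v| i ≤ (B *ᵥ |v|) i := fun i _ =>
    calc |v i| = |∑ j, B i j * v j| := congrArg _ (congrFun hv i).symm
      _ ≤ ∑ j, |B i j * v j| := Finset.abs_sum_le_sum_abs _ _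
      _ = (B *ᵥ |v|) i := by
        simp only [abs_mul, abs_of_nonneg (nonneg_of_mem_colStochastic hB), mulVec, dotProduct,
          Pi.abs_apply]
  have sum_eq := (sum_mulVec_of_mem_colStochastic (x := |v|) hB).symm
  exact funext fun i =>
    ((Finset.sum_eq_sum_iff_of_le abs_le).1 sum_eq i (Finset.mem_univ i)).symm

lemma exists_pos_mulVec_eq_self [Nonempty n] (hB : B ∈ colStochastic R n)
    (hB' : B.IsIrreducible) : ∃ p : n → R, (∀ i, 0 < p i) ∧ B *ᵥ p = p := by
  have hdet : (B - 1).det = 0 := exists_vecMul_eq_zero_iff.1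
    ⟨1, one_ne_zero, by rw [vecMul_sub, one_vecMul_of_mem_colStochastic hB, vecMul_one, sub_self]⟩
  obtain ⟨v, hv0, hv⟩ := exists_mulVec_eq_zero_iff.2 hdet
  rw [sub_mulVec, one_mulVec, sub_eq_zero] at hv
  obtain ⟨j, hj⟩ := Function.ne_iff.1 hv0
  have hBv := mulVec_abs_eq_self hB hv
  exact ⟨|v|, pos_of_mulVec_eq_self hB' hBv (fun i => abs_nonneg (v i)) (abs_pos.2 hj), hBv⟩

lemma eq_of_vecMul_eq_self (hB : B ∈ colStochastic R n) (hB' : B.IsIrreducible)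
    (hv : v ᵥ* B = v) (i j : n) : v i = v j := by
  have : Nonempty n := ⟨i⟩
  obtain ⟨m, hm⟩ := Finite.exists_max v
  have gap_fixed : Bᵀ *ᵥ (fun l => v m - v l) = fun l => v m - v l := by
    rw [mulVec_transpose]
    have : (fun l => v m - v l) = v m • 1 - v := by ext; simp
    rw [this, sub_vecMul, smul_vecMul, one_vecMul_of_mem_colStochastic hB, hv]
  have eq_max : ∀ l, v l = v m := fun l => by
    by_contra hl
    exact lt_irrefl (0 : R) ((pos_of_mulVec_eq_self hB'.transpose gap_fixed
      (fun l => sub_nonneg.2 (hm l)) (sub_pos.2 ((hm l).lt_of_ne hl)) m).trans_eq (sub_self _))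
  rw [eq_max i, eq_max j]

lemma exists_mulVec_eq_add_of_sum_eq_zero (hB : B ∈ colStochastic R n) (hB' : B.IsIrreducible)
    {b : n → R} (hb : ∑ i, b i = 0) : ∃ r, B *ᵥ r = r + b := by
  obtain ⟨r, hr⟩ := exists_mulVec_eq_of_forall_vecMul_eq_zero (M := B - 1) (b := b) fun x hx => by
    rw [vecMul_sub, vecMul_one, sub_eq_zero] at hx
    rcases isEmpty_or_nonempty n with _ | ⟨⟨j⟩⟩
    · simp
    · simp only [dotProduct, eq_of_vecMul_eq_self hB hB' hx _ j, ← Finset.mul_sum, hb, mul_zero]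
  exact ⟨r, by rw [← hr, sub_mulVec, one_mulVec, add_sub_cancel]⟩

lemma exists_mulVec_eq_add_sub_mul (hB : B ∈ colStochastic R n) (hB' : B.IsIrreducible)
    {d : n → R} (hd : ∀ i, 0 ≤ d i) (hd' : ∃ i, 0 < d i) :
    ∃ (p r : n → R) (c : R), (∀ i, 0 < p i) ∧ 0 < c ∧ B *ᵥ p = p ∧
      B *ᵥ r = r + fun i => (d i - c) * p i := by
  obtain ⟨j, hj⟩ := hd'
  have : Nonempty n := ⟨j⟩
  obtain ⟨p, hp, hBp⟩ := exists_pos_mulVec_eq_self hB hB'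
  have p_sum_pos : 0 < ∑ i, p i := Finset.sum_pos (fun i _ => hp i) Finset.univ_nonempty
  have rate_pos : 0 < ∑ i, d i * p i := Finset.sum_pos'
    (fun i _ => mul_nonneg (hd i) (hp i).le) ⟨j, Finset.mem_univ j, mul_pos hj (hp j)⟩
  obtain ⟨r, hr⟩ := exists_mulVec_eq_add_of_sum_eq_zero hB hB'
    (b := fun i => (d i - (∑ i, d i * p i) / ∑ i, p i) * p i) (by
      simp only [sub_mul, Finset.sum_sub_distrib, ← Finset.mul_sum,
        div_mul_cancel₀ _ p_sum_pos.ne', sub_self])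
  exact ⟨p, r, _, hp, div_pos rate_pos p_sum_pos, hBp, hr⟩

end StochasticMatrices

section CombinationPolicies

variable {N G : ℕ} {grp : Fin N → Fin G} {A : Matrix (Fin N) (Fin N) ℝ}

/-- Combination policies whose group blocks are irreducible left-stochastic matrices; in contrast
to primitive ones, the blocks may be periodic. -/
structure IsIrreduciblePolicy (grp : Fin N → Fin G) (A : Matrix (Fin N) (Fin N) ℝ) : Prop where
  off_group : ∀ l k, grp l ≠ grp k → A l k = 0
  mem_colStochastic : A ∈ colStochastic ℝ (Fin N)
  irreducible : ∀ m, (groupMatrix A grp m).IsIrreducible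

lemma IsCombinationPolicy.isIrreduciblePolicy (hA : IsCombinationPolicy grp A) :
    IsIrreduciblePolicy grp A where
  off_group := hA.off_group
  mem_colStochastic := by
    refine mem_colStochastic_iff_sum.2 ⟨fun l k => ?_, hA.leftStochastic⟩
    by_cases h : grp l = grp k
    · exact (hA.primitive (grp k)).nonneg ⟨l, h⟩ ⟨k, rfl⟩
    · exact (hA.off_group l k h).ge
  irreducible m := (hA.primitive m).isIrreducible

lemma sum_eq_sum_group (m : Fin G) {f : Fin N → ℝ} (hf : ∀ k, grp k ≠ m → f k = 0) :
    ∑ k, f k = ∑ k : {k // grp k = m}, f k := by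
  rw [← Finset.sum_subtype (Finset.univ.filter (grp · = m)) (by simp) f]
  exact (Finset.sum_filter_of_ne fun k _ hk => not_imp_comm.1 (hf k) hk).symm

namespace IsIrreduciblePolicy

variable (hA : IsIrreduciblePolicy grp A)
include hA

lemma groupMatrix_mem_colStochastic (m : Fin G) :
    groupMatrix A grp m ∈ colStochastic ℝ {k // grp k = m} :=
  mem_colStochastic_iff_sum.2 ⟨fun _ _ => nonneg_of_mem_colStochastic hA.mem_colStochastic,
    fun k => (sum_eq_sum_group m fun l hl => hA.off_group l k fun h => hl (h.trans k.2)).symm.trans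
      (sum_col_of_mem_colStochastic hA.mem_colStochastic k)⟩

lemma mulVec_apply_eq_groupMatrix_mulVec (v : Fin N → ℝ) (m : Fin G) (l : {k // grp k = m}) :
    (A *ᵥ v) l = (groupMatrix A grp m *ᵥ fun k => v k) l := by
  simp only [mulVec, dotProduct]
  exact sum_eq_sum_group m fun k hk => by
    rw [hA.off_group l k fun h => hk (h.symm.trans l.2), zero_mul]

lemma exists_mulVec_eq_add_sub_mul {d : Fin N → ℝ} (hd : ∀ k, 0 ≤ d k)
    (hd' : ∀ m, ∃ k, grp k = m ∧ 0 < d k) :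
    ∃ p r c : Fin N → ℝ, (∀ k, 0 < p k) ∧ (∀ k, 0 < c k) ∧ A *ᵥ p = p ∧
      A *ᵥ r = r + fun k => (d k - c k) * p k := by
  choose p r c hp hc hAp hAr using fun m =>
    DiffusionNetwork.exists_mulVec_eq_add_sub_mul (hA.groupMatrix_mem_colStochastic m)
      (hA.irreducible m) (fun k => hd k) (Subtype.exists.2 ((hd' m).imp fun _ h => ⟨h.1, h.2⟩))
  have glue_eq : ∀ (f : ∀ m, {k // grp k = m} → ℝ) (m : Fin G),
      (fun k : {k // grp k = m} => f (grp k) ⟨k, rfl⟩) = f m := fun f m => by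
    ext ⟨k, rfl⟩
    rfl
  refine ⟨fun k => p (grp k) ⟨k, rfl⟩, fun k => r (grp k) ⟨k, rfl⟩, fun k => c (grp k),
    fun k => hp _ _, fun k => hc _, funext fun k => ?_, funext fun k => ?_⟩
  · rw [hA.mulVec_apply_eq_groupMatrix_mulVec _ (grp k) ⟨k, rfl⟩, glue_eq, hAp]
  · rw [hA.mulVec_apply_eq_groupMatrix_mulVec _ (grp k) ⟨k, rfl⟩, glue_eq, hAr]
    rfl

end IsIrreduciblePolicy

end CombinationPolicies

section PerturbedWeights

lemma exists_pos_forall_le {ι : Type*} [Finite ι] {f : ι → ℝ} (hf : ∀ i, 0 < f i) :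
    ∃ a, 0 < a ∧ ∀ i, a ≤ f i :=
  let ⟨a, ha⟩ := Finite.exists_ge fun i => (⟨f i, hf i⟩ : Set.Ioi (0 : ℝ))
  ⟨a, a.2, ha⟩

open Topology in
lemma exists_eventually_perturbed_weights {ι : Type*} [Fintype ι] {A : Matrix ι ι ℝ}
    {p r c d : ι → ℝ} (hp : ∀ k, 0 < p k) (hc : ∀ k, 0 < c k) (hAp : A *ᵥ p = p)
    (hAr : A *ᵥ r = r + fun k => (d k - c k) * p k) (L : ℝ) :
    ∃ κ b : ℝ, 0 < κ ∧ ∀ᶠ u in 𝓝[>] (0 : ℝ), ∃ q : ι → ℝ, (∀ k, 1 ≤ q k) ∧ (∀ k, q k ≤ b) ∧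
      ∀ l, (A *ᵥ q) l * (1 - u * d l + u ^ 2 * L ^ 2) ≤ (1 - κ * u) * q l := by
  obtain ⟨c₀, hc₀, hc₀_le⟩ := exists_pos_forall_le hc
  obtain ⟨p₀, hp₀, hp₀_le⟩ := exists_pos_forall_le hp
  obtain ⟨p₁, hp₁⟩ := Finite.exists_le p
  have tendsto_weight : ∀ k, Tendsto (fun u => p k + u * r k) (𝓝 0) (𝓝 (p k)) := fun k =>
    Continuous.tendsto' (by fun_prop) _ _ (by simp)
  have lower : ∀ᶠ u in 𝓝 (0 : ℝ), ∀ k, p₀ / 2 < p k + u * r k := eventually_all.2 fun k =>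
    (tendsto_weight k).eventually_const_lt ((half_lt_self hp₀).trans_le (hp₀_le k))
  have upper : ∀ᶠ u in 𝓝 (0 : ℝ), ∀ k, p k + u * r k < p₁ + 1 := eventually_all.2 fun k =>
    (tendsto_weight k).eventually_lt_const ((hp₁ k).trans_lt (lt_add_one p₁))
  have slope_pos : ∀ᶠ u in 𝓝 (0 : ℝ), ∀ l, 0 < (p l + u * r l) * (d l - c₀ / 2 - u * L ^ 2)
      - (d l - c l) * p l * (1 - u * d l + u ^ 2 * L ^ 2) := eventually_all.2 fun l => by
    refine Tendsto.eventually_const_lt (v := (c l - c₀ / 2) * p l)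
      (mul_pos (by linarith [hc₀_le l]) (hp l))
      (Continuous.tendsto' (by fun_prop) _ _ (by ring))
  refine ⟨c₀ / 2, (p₀ / 2)⁻¹ * (p₁ + 1), half_pos hc₀, ?_⟩
  filter_upwards [self_mem_nhdsWithin, nhdsWithin_le_nhds lower, nhdsWithin_le_nhds upper,
    nhdsWithin_le_nhds slope_pos] with u (hu : 0 < u) hlower hupper hslope
  have scale_pos : 0 < (p₀ / 2)⁻¹ := inv_pos.2 (half_pos hp₀)
  refine ⟨(p₀ / 2)⁻¹ • (p + u • r), fun k => ?_, fun k => ?_, fun l => ?_⟩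
  · exact (inv_mul_cancel₀ (half_pos hp₀).ne').symm.trans_le
      (mul_le_mul_of_nonneg_left (hlower k).le scale_pos.le)
  · exact mul_le_mul_of_nonneg_left (hupper k).le scale_pos.le
  · simp only [mulVec_smul, mulVec_add, hAp, hAr, Pi.smul_apply, Pi.add_apply, smul_eq_mul]
    linarith [mul_pos scale_pos (mul_pos hu (hslope l))]

end PerturbedWeights

section Calculus

variable {E : Type*} [NormedAddCommGroup E] [InnerProductSpace ℝ E]

lemma norm_add_smul_sq_le {e g : E} {lam L t : ℝ} (ht : 0 ≤ t)
    (hinner : lam * ‖e‖ ^ 2 ≤ -⟪e, g⟫) (hnorm : ‖g‖ ≤ L * ‖e‖) :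
    ‖e + t • g‖ ^ 2 ≤ (1 - 2 * t * lam + t ^ 2 * L ^ 2) * ‖e‖ ^ 2 := by
  have quadratic : ‖g‖ ^ 2 ≤ (L * ‖e‖) ^ 2 := pow_le_pow_left₀ (norm_nonneg g) hnorm 2
  rw [norm_add_sq_real, inner_smul_right, norm_smul, mul_pow, Real.norm_eq_abs, sq_abs]
  linarith [mul_le_mul_of_nonneg_left hinner ht, mul_le_mul_of_nonneg_left quadratic (sq_nonneg t)]

lemma norm_le_of_abs_inner_le {T : E →L[ℝ] E} (hT : T.IsSymmetric) {L : ℝ} (hL : 0 ≤ L)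
    (hT_le : ∀ v, |⟪T v, v⟫| ≤ L * ‖v‖ ^ 2) : ‖T‖ ≤ L := by
  rw [T.norm_eq_iSup_rayleighQuotient hT]
  refine ciSup_le fun v => ?_
  rw [ContinuousLinearMap.rayleighQuotient, abs_div, abs_sq]
  exact div_le_of_le_mul₀ (sq_nonneg _) hL (hT_le v)

variable [CompleteSpace E] {f : E → ℝ}

lemma gradient_eq_zero_of_isLocalMin {w : E} (h : IsLocalMin f w) : ∇ f w = 0 := by
  rw [gradient, h.fderiv_eq_zero, map_zero]

lemma isSymmetric_fderiv_gradient (hf : Differentiable ℝ f) {w : E}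
    (hf' : DifferentiableAt ℝ (∇ f) w) : (fderiv ℝ (∇ f) w).IsSymmetric := by
  let B : E →L[ℝ] E →L[ℝ] ℝ :=
    (isBoundedBilinearMap_inner (𝕜 := ℝ) (E := E)).toContinuousLinearMap
  have first_deriv : ∀ y, HasFDerivAt f (B (∇ f y)) y := fun y => (hf y).hasGradientAt.hasFDerivAt
  have second_deriv : HasFDerivAt (fun y => B (∇ f y)) (B.comp (fderiv ℝ (∇ f) w)) w :=
    B.hasFDerivAt.comp w hf'.hasFDerivAt
  exact fun u v => (second_derivative_symmetric first_deriv second_deriv u v).trans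
    (real_inner_comm _ _)

lemma norm_gradient_le_of_norm_fderiv_le {L : ℝ} (hf' : Differentiable ℝ (∇ f))
    (hL : ∀ w, ‖fderiv ℝ (∇ f) w‖ ≤ L) {wo : E} (hwo : ∇ f wo = 0) (w : E) :
    ‖∇ f w‖ ≤ L * ‖wo - w‖ := by
  have := convex_univ.norm_image_sub_le_of_norm_fderiv_le (fun x _ => hf' x) (fun x _ => hL x)
    (Set.mem_univ wo) (Set.mem_univ w)
  rwa [hwo, sub_zero, norm_sub_rev] at this

lemma mul_sq_le_neg_inner_gradient {lam : ℝ} (hf' : Differentiable ℝ (∇ f))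
    (hlam : ∀ w v, lam * ‖v‖ ^ 2 ≤ ⟪v, fderiv ℝ (∇ f) w v⟫) {wo : E} (hwo : ∇ f wo = 0) (w : E) :
    lam * ‖wo - w‖ ^ 2 ≤ -⟪wo - w, ∇ f w⟫ := by
  set v := w - wo with hv
  have deriv_along_segment : ∀ t : ℝ, HasDerivAt (fun t : ℝ => ⟪v, ∇ f (wo + t • v)⟫)
      ⟪v, fderiv ℝ (∇ f) (wo + t • v) v⟫ t := fun t => by
    have segment : HasDerivAt (fun t : ℝ => wo + t • v) v t := by
      simpa using ((hasDerivAt_id t).smul_const v).const_add wo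
    simpa using (hasDerivAt_const t v).inner ℝ
      ((hf' (wo + t • v)).hasFDerivAt.comp_hasDerivAt t segment)
  obtain ⟨t, -, ht⟩ := exists_hasDerivAt_eq_slope _ _ (zero_lt_one' ℝ)
    (fun t _ => (deriv_along_segment t).continuousAt.continuousWithinAt)
    (fun t _ => deriv_along_segment t)
  calc lam * ‖wo - w‖ ^ 2 = lam * ‖v‖ ^ 2 := by rw [norm_sub_rev]
    _ ≤ ⟪v, fderiv ℝ (∇ f) (wo + t • v) v⟫ := hlam _ v
    _ = ⟪v, ∇ f w⟫ := by
      rw [ht]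
      simp only [one_smul, zero_smul, add_zero, hwo, inner_zero_right, sub_zero, div_one, hv,
        add_sub_cancel]
    _ = -⟪wo - w, ∇ f w⟫ := by rw [← inner_neg_left, neg_sub]

end Calculus

section RegularGradients

variable {N M G : ℕ} {grp : Fin N → Fin G} {J : Fin N → Vec M → ℝ} {wo : NetVec N M}

/-- First-order conditions on the costs under which diffusion is stable: the gradient of every cost
grows at most linearly and is one-point strongly monotone around `wo k` with modulus `lam k`, where
`wo` is shared within each group and every group has an agent with `0 < lam k`. -/
structure HasRegularGradients (grp : Fin N → Fin G) (J : Fin N → Vec M → ℝ) (wo : NetVec N M)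
    (lam : Fin N → ℝ) (L : ℝ) : Prop where
  differentiable : ∀ k, Differentiable ℝ (J k)
  continuous_gradient : ∀ k, Continuous (∇ (J k))
  common_center : ∀ k l, grp k = grp l → wo k = wo l
  norm_gradient_le : ∀ k w, ‖∇ (J k) w‖ ≤ L * ‖wo k - w‖
  strongly_monotone : ∀ k w, lam k * ‖wo k - w‖ ^ 2 ≤ -⟪wo k - w, ∇ (J k) w⟫
  lam_nonneg : ∀ k, 0 ≤ lam k
  exists_lam_pos : ∀ m, ∃ k, grp k = m ∧ 0 < lam k

lemma IsCostFamily.norm_hessian_le {lamL lamU : Fin N → ℝ}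
    (hJ : IsCostFamily grp J wo lamL lamU) (k : Fin N) (w : Vec M) :
    ‖hessian (J k) w‖ ≤ |lamU k| := by
  refine norm_le_of_abs_inner_le
    (isSymmetric_fderiv_gradient (hJ.differentiable k) (hJ.differentiable_gradient k w))
    (abs_nonneg _) fun v => ?_
  rw [real_inner_comm, abs_of_nonneg]
  · exact (hJ.hessian_upper k w v).trans
      (mul_le_mul_of_nonneg_right (le_abs_self _) (sq_nonneg _))
  · exact (mul_nonneg (hJ.lamL_nonneg k) (sq_nonneg _)).trans (hJ.hessian_lower k w v)

lemma IsCostFamily.exists_hasRegularGradients {lamL lamU : Fin N → ℝ}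
    (hJ : IsCostFamily grp J wo lamL lamU) : ∃ L, HasRegularGradients grp J wo lamL L := by
  obtain ⟨L, hL⟩ := Finite.exists_le fun k => |lamU k|
  have gradient_zero : ∀ k, ∇ (J k) (wo k) = 0 := fun k =>
    gradient_eq_zero_of_isLocalMin ((hJ.minimizer k).isLocalMin univ_mem)
  exact ⟨L, hJ.differentiable, fun k => (hJ.differentiable_gradient k).continuous,
    hJ.common_minimizer,
    fun k => norm_gradient_le_of_norm_fderiv_le (hJ.differentiable_gradient k)
      (fun w => (hJ.norm_hessian_le k w).trans (hL k)) (gradient_zero k),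
    fun k => mul_sq_le_neg_inner_gradient (hJ.differentiable_gradient k) (hJ.hessian_lower k)
      (gradient_zero k),
    hJ.lamL_nonneg, hJ.strong⟩

end RegularGradients

section Operators

variable {ι E : Type*} [NormedAddCommGroup E] [NormedSpace ℝ E]

/-- The agentwise scaling `x ↦ col{t_k x_k}`. It serves both to apply the step-sizes and, with
`t_k = √q_k`, to pass to the norm weighted by `q`. -/
noncomputable def scale (t : ι → ℝ) : PiLp 2 (fun _ : ι => E) →L[ℝ] PiLp 2 (fun _ : ι => E) :=
  (PiLp.continuousLinearEquiv 2 ℝ fun _ : ι => E).symm ∘L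
    ContinuousLinearMap.pi fun k => t k • PiLp.proj 2 (fun _ : ι => E) k

lemma scale_apply (t : ι → ℝ) (x : PiLp 2 (fun _ : ι => E)) (k : ι) :
    scale t x k = t k • x k := by
  simp [scale]

variable [Fintype ι]

/-- The combination step `x ↦ col{∑_ℓ a_{ℓk} x_ℓ}`. -/
noncomputable def combine (A : Matrix ι ι ℝ) :
    PiLp 2 (fun _ : ι => E) →L[ℝ] PiLp 2 (fun _ : ι => E) :=
  (PiLp.continuousLinearEquiv 2 ℝ fun _ : ι => E).symm ∘L
    ContinuousLinearMap.pi fun k => ∑ l, A l k • PiLp.proj 2 (fun _ : ι => E) l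

lemma combine_apply (A : Matrix ι ι ℝ) (x : PiLp 2 (fun _ : ι => E)) (k : ι) :
    combine A x k = ∑ l, A l k • x l := by
  simp [combine]

lemma norm_scale_sq (t : ι → ℝ) (x : PiLp 2 (fun _ : ι => E)) :
    ‖scale t x‖ ^ 2 = ∑ k, t k ^ 2 * ‖x k‖ ^ 2 := by
  simp only [PiLp.norm_sq_eq_of_L2, scale_apply, norm_smul, mul_pow, Real.norm_eq_abs, sq_abs]

lemma norm_scale_le {t : ι → ℝ} {b : ℝ} (hb : 0 ≤ b) (ht : ∀ k, |t k| ≤ b)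
    (x : PiLp 2 (fun _ : ι => E)) : ‖scale t x‖ ≤ b * ‖x‖ := by
  rw [← sq_le_sq₀ (norm_nonneg _) (by positivity), norm_scale_sq, mul_pow, PiLp.norm_sq_eq_of_L2,
    Finset.mul_sum]
  exact Finset.sum_le_sum fun k _ =>
    mul_le_mul_of_nonneg_right (sq_le_sq.2 ((ht k).trans (le_abs_self b))) (sq_nonneg _)

lemma norm_le_norm_scale {t : ι → ℝ} (ht : ∀ k, 1 ≤ |t k|) (x : PiLp 2 (fun _ : ι => E)) :
    ‖x‖ ≤ ‖scale t x‖ := by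
  rw [← sq_le_sq₀ (norm_nonneg _) (norm_nonneg _), norm_scale_sq, PiLp.norm_sq_eq_of_L2]
  gcongr with k
  exact le_mul_of_one_le_left (sq_nonneg _) ((one_le_sq_iff_one_le_abs _).2 (ht k))

variable [DecidableEq ι] {A : Matrix ι ι ℝ}

lemma norm_combine_apply_sq_le (hA : A ∈ colStochastic ℝ ι) (y : PiLp 2 (fun _ : ι => E))
    (k : ι) : ‖combine A y k‖ ^ 2 ≤ ∑ l, A l k * ‖y l‖ ^ 2 := by
  rw [combine_apply]
  exact ((convexOn_norm convex_univ).pow (fun _ _ => norm_nonneg _) 2).map_sum_le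
    (fun _ _ => nonneg_of_mem_colStochastic hA) (sum_col_of_mem_colStochastic hA k)
    (fun _ _ => Set.mem_univ _)

lemma norm_scale_combine_sq_le (hA : A ∈ colStochastic ℝ ι) (t : ι → ℝ)
    (y : PiLp 2 (fun _ : ι => E)) :
    ‖scale t (combine A y)‖ ^ 2 ≤ ∑ l, (A *ᵥ t ^ 2) l * ‖y l‖ ^ 2 :=
  calc ‖scale t (combine A y)‖ ^ 2 = ∑ k, t k ^ 2 * ‖combine A y k‖ ^ 2 := norm_scale_sq _ _
    _ ≤ ∑ k, t k ^ 2 * ∑ l, A l k * ‖y l‖ ^ 2 := by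
      gcongr with k
      exact norm_combine_apply_sq_le hA y k
    _ = ∑ l, (A *ᵥ t ^ 2) l * ‖y l‖ ^ 2 := by
      simp only [mulVec, dotProduct, Pi.pow_apply, Finset.mul_sum, Finset.sum_mul]
      rw [Finset.sum_comm]
      exact Finset.sum_congr rfl fun l _ => Finset.sum_congr rfl fun k _ => by ring

lemma norm_scale_combine_sq_le_mul (hA : A ∈ colStochastic ℝ ι) {t γ : ι → ℝ} {θ : ℝ}
    (ht : ∀ l, (A *ᵥ t ^ 2) l * γ l ≤ θ * t l ^ 2) {x y : PiLp 2 (fun _ : ι => E)}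
    (hy : ∀ l, ‖y l‖ ^ 2 ≤ γ l * ‖x l‖ ^ 2) :
    ‖scale t (combine A y)‖ ^ 2 ≤ θ * ‖scale t x‖ ^ 2 :=
  calc ‖scale t (combine A y)‖ ^ 2 ≤ ∑ l, (A *ᵥ t ^ 2) l * ‖y l‖ ^ 2 :=
      norm_scale_combine_sq_le hA t y
    _ ≤ ∑ l, (A *ᵥ t ^ 2) l * (γ l * ‖x l‖ ^ 2) := by
      gcongr with l
      · exact nonneg_mulVec_of_mem_colStochastic hA (fun k => sq_nonneg (t k)) l
      · exact hy l
    _ ≤ ∑ l, θ * (t l ^ 2 * ‖x l‖ ^ 2) := Finset.sum_le_sum fun l _ => by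
      simpa only [mul_assoc] using mul_le_mul_of_nonneg_right (ht l) (sq_nonneg ‖x l‖)
    _ = θ * ‖scale t x‖ ^ 2 := by rw [norm_scale_sq, Finset.mul_sum]

end Operators

section Contraction

variable {N M G : ℕ} {grp : Fin N → Fin G} {A : Matrix (Fin N) (Fin N) ℝ} {J : Fin N → Vec M → ℝ}
  {wo : NetVec N M} {lam : Fin N → ℝ} {L : ℝ}

/-- The error after one diffusion step from `W` in which the exact gradients are used. -/
noncomputable def exactStepError (A : Matrix (Fin N) (Fin N) ℝ) (μ : Fin N → ℝ)
    (J : Fin N → Vec M → ℝ) (wo W : NetVec N M) : NetVec N M :=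
  combine A (wo - W + scale μ (netGrad J W))

lemma HasRegularGradients.norm_gradient_step_sq_le (hJ : HasRegularGradients grp J wo lam L)
    {ρ u : ℝ} {μ : Fin N → ℝ} {k : Fin N} (hμ : 0 ≤ μ k) (hρμ : ρ * u ≤ μ k) (hμu : μ k ≤ u)
    (W : NetVec N M) : ‖(wo - W + scale μ (netGrad J W)) k‖ ^ 2 ≤
      (1 - u * (2 * ρ * lam k) + u ^ 2 * L ^ 2) * ‖(wo - W) k‖ ^ 2 := by
  rw [PiLp.add_apply, scale_apply]
  refine (norm_add_smul_sq_le hμ (hJ.strongly_monotone k (W k))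
    (hJ.norm_gradient_le k (W k))).trans (mul_le_mul_of_nonneg_right ?_ (sq_nonneg _))
  have linear_term := mul_le_mul_of_nonneg_right hρμ (hJ.lam_nonneg k)
  have quadratic_term := mul_le_mul_of_nonneg_right (pow_le_pow_left₀ hμ hμu 2) (sq_nonneg L)
  linarith

open Topology in
lemma exists_eventually_norm_scale_exactStepError_le (hA : IsIrreduciblePolicy grp A)
    (hJ : HasRegularGradients grp J wo lam L) {ρ : ℝ} (hρ : 0 < ρ) :
    ∃ κ b : ℝ, 0 < κ ∧ ∀ᶠ u in 𝓝[>] (0 : ℝ), ∃ t : Fin N → ℝ,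
      (∀ k, 1 ≤ |t k|) ∧ (∀ k, |t k| ≤ b) ∧ ∀ μ : Fin N → ℝ, (∀ k, ρ * u ≤ μ k) →
        (∀ k, μ k ≤ u) → ∀ W : NetVec N M,
          ‖scale t (exactStepError A μ J wo W)‖ ^ 2 ≤ (1 - κ * u) * ‖scale t (wo - W)‖ ^ 2 := by
  obtain ⟨p, r, c, hp, hc, hAp, hAr⟩ := hA.exists_mulVec_eq_add_sub_mul
    (d := fun k => 2 * ρ * lam k) (fun k => mul_nonneg (by positivity) (hJ.lam_nonneg k))
    (fun m => (hJ.exists_lam_pos m).imp fun k hk => ⟨hk.1, mul_pos (by positivity) hk.2⟩)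
  obtain ⟨κ, b, hκ, hq⟩ := exists_eventually_perturbed_weights hp hc hAp hAr L
  refine ⟨κ, b, hκ, ?_⟩
  filter_upwards [hq, self_mem_nhdsWithin] with u ⟨q, one_le_q, q_le, hAq⟩ (hu : 0 < u)
  have sq_sqrt : (fun k => √(q k)) ^ 2 = q :=
    funext fun k => Real.sq_sqrt (zero_le_one.trans (one_le_q k))
  refine ⟨fun k => √(q k), fun k => ?_, fun k => ?_, fun μ hρμ hμu W => ?_⟩
  · rw [abs_of_nonneg (Real.sqrt_nonneg _)]
    exact Real.one_le_sqrt.2 (one_le_q k)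
  · rw [abs_of_nonneg (Real.sqrt_nonneg _)]
    exact (Real.sqrt_le_self_iff.2 (.inr (one_le_q k))).trans (q_le k)
  · refine norm_scale_combine_sq_le_mul hA.mem_colStochastic (fun l => ?_) fun l =>
      hJ.norm_gradient_step_sq_le ((mul_pos hρ hu).le.trans (hρμ l)) (hρμ l) (hμu l) W
    rw [sq_sqrt, Real.sq_sqrt (zero_le_one.trans (one_le_q l))]
    exact hAq l

end Contraction

section FourthMoment

variable {E : Type*} [NormedAddCommGroup E] {Ω : Type*} {mΩ : MeasurableSpace Ω} {P : Measure Ω}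

lemma integrable_norm_pow_four {f : Ω → E} (hf : MemLp f 4 P) :
    Integrable (fun ω => ‖f ω‖ ^ 4) P :=
  MemLp.integrable_norm_pow (p := 4) (by simpa only [Nat.cast_ofNat] using hf) four_ne_zero

lemma memLp_four_of_integrable {f : Ω → E} (hfm : AEStronglyMeasurable f P)
    (hf : Integrable (fun ω => ‖f ω‖ ^ 4) P) : MemLp f 4 P := by
  rw [← integrable_norm_rpow_iff hfm (by norm_num) (by norm_num)]
  simpa only [ENNReal.toReal_ofNat, Real.rpow_ofNat] using hf

lemma ofReal_integral_norm_pow_four {f : Ω → E} (hf : MemLp f 4 P) :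
    ENNReal.ofReal (∫ ω, ‖f ω‖ ^ 4 ∂P) = ∫⁻ ω, ‖f ω‖ₑ ^ 4 ∂P := by
  rw [ofReal_integral_eq_lintegral_ofReal (integrable_norm_pow_four hf)
    (ae_of_all _ fun ω => by positivity)]
  simp only [ENNReal.ofReal_pow (norm_nonneg _), ofReal_norm]

lemma sq_lintegral_enorm_sq_le [IsProbabilityMeasure P] {f : Ω → E}
    (hf : AEStronglyMeasurable f P) :
    (∫⁻ ω, ‖f ω‖ₑ ^ 2 ∂P) ^ 2 ≤ ∫⁻ ω, ‖f ω‖ₑ ^ 4 ∂P := by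
  have lyapunov : eLpNorm f 2 P ^ 4 ≤ eLpNorm f 4 P ^ 4 :=
    pow_le_pow_left' (eLpNorm_le_eLpNorm_of_exponent_le (by norm_num) hf) 4
  have second := eLpNorm_nnreal_pow_eq_lintegral (f := f) (μ := P) (two_ne_zero (α := NNReal))
  have fourth := eLpNorm_nnreal_pow_eq_lintegral (f := f) (μ := P) (four_ne_zero (α := NNReal))
  simp only [ENNReal.coe_ofNat, NNReal.coe_ofNat, ENNReal.rpow_ofNat] at second fourth
  rwa [← second, ← fourth, ← pow_mul]

lemma limsup_lintegral_enorm_sq_le [IsProbabilityMeasure P] {f : ℕ → Ω → E}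
    (hf : ∀ i, AEStronglyMeasurable (f i) P) {c : ℝ≥0∞}
    (h : limsup (fun i => ∫⁻ ω, ‖f i ω‖ₑ ^ 4 ∂P) atTop ≤ c ^ 2) :
    limsup (fun i => ∫⁻ ω, ‖f i ω‖ₑ ^ 2 ∂P) atTop ≤ c := by
  rw [← ENNReal.pow_le_pow_left_iff two_ne_zero,
    (pow_left_mono 2).map_limsup_of_continuousAt _ (ENNReal.continuous_pow 2).continuousAt]
  exact (limsup_le_limsup (.of_forall fun i => sq_lintegral_enorm_sq_le (hf i))).trans h

variable [InnerProductSpace ℝ E]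

lemma norm_add_pow_four_le (x n : E) {δ : ℝ} (hδ : 0 < δ) (hδ_le : δ ≤ 1) :
    ‖x + n‖ ^ 4 ≤ (1 + δ) * ‖x‖ ^ 4 + 4 * ⟪‖x‖ ^ 2 • x, n⟫ + 19 / δ * ‖n‖ ^ 4 := by
  have expand : ‖x + n‖ ^ 4 = (‖x‖ ^ 2 + 2 * ⟪x, n⟫ + ‖n‖ ^ 2) ^ 2 := by
    rw [← norm_add_sq_real]
    ring
  have cauchy_schwarz : ⟪x, n⟫ ^ 2 ≤ ‖x‖ ^ 2 * ‖n‖ ^ 2 := by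
    rw [← mul_pow]
    exact sq_le_sq' (neg_le_of_abs_le (abs_real_inner_le_norm x n)) (real_inner_le_norm x n)
  have young : 8 * (‖x‖ ^ 2 * ‖n‖ ^ 2) ≤ δ * ‖x‖ ^ 4 + 16 / δ * ‖n‖ ^ 4 := by
    have square : (δ * ‖x‖ ^ 2 - 4 * ‖n‖ ^ 2) ^ 2 / δ =
        δ * ‖x‖ ^ 4 + 16 / δ * ‖n‖ ^ 4 - 8 * (‖x‖ ^ 2 * ‖n‖ ^ 2) := by
      field_simp
      ring
    have := square ▸ div_nonneg (sq_nonneg (δ * ‖x‖ ^ 2 - 4 * ‖n‖ ^ 2)) hδ.le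
    linarith
  have three_le : 3 * ‖n‖ ^ 4 ≤ 3 / δ * ‖n‖ ^ 4 :=
    mul_le_mul_of_nonneg_right (le_div_self zero_le_three hδ hδ_le) (by positivity)
  have split_coeff : 19 / δ * ‖n‖ ^ 4 = 16 / δ * ‖n‖ ^ 4 + 3 / δ * ‖n‖ ^ 4 := by ring
  rw [expand, inner_smul_left, conj_trivial]
  linarith [sq_nonneg (⟪x, n⟫ - ‖n‖ ^ 2)]

lemma integrable_inner_norm_sq_smul {X n : Ω → E} (hX : MemLp X 4 P) (hn : MemLp n 4 P) :
    Integrable (fun ω => ⟪‖X ω‖ ^ 2 • X ω, n ω⟫) P := by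
  refine ((integrable_norm_pow_four hX).add (integrable_norm_pow_four hn)).mono'
    (((hX.1.norm.pow 2).smul hX.1).inner hn.1) (ae_of_all _ fun ω => ?_)
  calc ‖⟪‖X ω‖ ^ 2 • X ω, n ω⟫‖ ≤ ‖‖X ω‖ ^ 2 • X ω‖ * ‖n ω‖ := norm_inner_le_norm _ _
    _ = ‖X ω‖ ^ 3 * ‖n ω‖ := by rw [norm_smul, norm_pow, norm_norm, ← pow_succ]
    _ ≤ ‖X ω‖ ^ 4 + ‖n ω‖ ^ 4 := by
      nlinarith [sq_nonneg (‖X ω‖ ^ 2 - ‖X ω‖ * ‖n ω‖), sq_nonneg (‖X ω‖ ^ 2 - ‖n ω‖ ^ 2)]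

variable [CompleteSpace E] {m : MeasurableSpace Ω}

lemma integral_inner_eq_zero_of_condExp_eq_zero [IsFiniteMeasure P] (hm : m ≤ mΩ) {Z n : Ω → E}
    (hZ : StronglyMeasurable[m] Z) (hZn : Integrable (fun ω => ⟪Z ω, n ω⟫) P)
    (hn : Integrable n P) (hn_zero : P[n | m] =ᵐ[P] 0) : ∫ ω, ⟪Z ω, n ω⟫ ∂P = 0 := by
  have pull_out := condExp_bilin_of_stronglyMeasurable_left
    (isBoundedBilinearMap_inner (𝕜 := ℝ) (E := E)).toContinuousLinearMap hZ hZn hn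
  rw [← integral_condExp hm]
  refine integral_eq_zero_of_ae (pull_out.trans ?_)
  filter_upwards [hn_zero] with ω hω
  rw [hω]
  exact inner_zero_right (Z ω)

lemma integral_norm_add_pow_four_le [IsFiniteMeasure P] (hm : m ≤ mΩ) {X n : Ω → E}
    (hXm : StronglyMeasurable[m] X) (hX : MemLp X 4 P) (hn : MemLp n 4 P)
    (hn_zero : P[n | m] =ᵐ[P] 0) {δ : ℝ} (hδ : 0 < δ) (hδ_le : δ ≤ 1) :
    ∫ ω, ‖X ω + n ω‖ ^ 4 ∂P ≤
      (1 + δ) * ∫ ω, ‖X ω‖ ^ 4 ∂P + 19 / δ * ∫ ω, ‖n ω‖ ^ 4 ∂P := by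
  have iX := (integrable_norm_pow_four hX).const_mul (1 + δ)
  have iXn := integrable_inner_norm_sq_smul hX hn
  have i_n := (integrable_norm_pow_four hn).const_mul (19 / δ)
  have cross_term : ∫ ω, ⟪‖X ω‖ ^ 2 • X ω, n ω⟫ ∂P = 0 :=
    integral_inner_eq_zero_of_condExp_eq_zero hm ((hXm.norm.pow 2).smul hXm) iXn
      (hn.integrable (by norm_num)) hn_zero
  refine (integral_mono (integrable_norm_pow_four (hX.add hn)) ((iX.add (iXn.const_mul 4)).add i_n)
    fun ω => norm_add_pow_four_le (X ω) (n ω) hδ hδ_le).trans_eq ?_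
  rw [integral_add' (iX.add (iXn.const_mul 4)) i_n, integral_add' iX (iXn.const_mul 4)]
  simp only [integral_const_mul, cross_term, mul_zero, add_zero]

lemma integral_norm_add_pow_four_le_of_contracting [IsFiniteMeasure P] (hm : m ≤ mΩ)
    {X Y n : Ω → E} {δ s τ : ℝ} (hδ : 0 < δ) (hδ_le : δ ≤ 1) (hs : 38 * s ≤ δ ^ 2)
    (hX : MemLp X 4 P) (hYm : StronglyMeasurable[m] Y) (hn : MemLp n 4 P)
    (hYX : ∀ ω, ‖Y ω‖ ^ 2 ≤ (1 - δ) * ‖X ω‖ ^ 2) (hn_zero : P[n | m] =ᵐ[P] 0)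
    (hnX : ∫ ω, ‖n ω‖ ^ 4 ∂P ≤ s * ∫ ω, ‖X ω‖ ^ 4 ∂P + τ) :
    ∫ ω, ‖Y ω + n ω‖ ^ 4 ∂P ≤ (1 - δ / 2) * ∫ ω, ‖X ω‖ ^ 4 ∂P + 19 * τ / δ := by
  have hY : MemLp Y 4 P := hX.of_le (hYm.mono hm).aestronglyMeasurable <| ae_of_all _ fun ω =>
    pow_le_pow_iff_left₀ (norm_nonneg _) (norm_nonneg _) two_ne_zero |>.1 <|
      (hYX ω).trans (mul_le_of_le_one_left (sq_nonneg _) (sub_le_self 1 hδ.le))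
  have contraction : ∫ ω, ‖Y ω‖ ^ 4 ∂P ≤ (1 - δ) ^ 2 * ∫ ω, ‖X ω‖ ^ 4 ∂P := by
    rw [← integral_const_mul]
    refine integral_mono (integrable_norm_pow_four hY) ((integrable_norm_pow_four hX).const_mul _)
      fun ω => ?_
    simpa only [mul_pow, ← pow_mul] using pow_le_pow_left₀ (sq_nonneg _) (hYX ω) 2
  set x := ∫ ω, ‖X ω‖ ^ 4 ∂P
  have : 0 ≤ x := integral_nonneg fun ω => by positivity
  calc ∫ ω, ‖Y ω + n ω‖ ^ 4 ∂P
      ≤ (1 + δ) * ∫ ω, ‖Y ω‖ ^ 4 ∂P + 19 / δ * ∫ ω, ‖n ω‖ ^ 4 ∂P :=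
        integral_norm_add_pow_four_le hm hYm hY hn hn_zero hδ hδ_le
    _ ≤ (1 + δ) * ((1 - δ) ^ 2 * x) + 19 / δ * (s * x + τ) := by gcongr
    _ = ((1 + δ) * (1 - δ) ^ 2 + 38 * s / (2 * δ)) * x + 19 * τ / δ := by ring
    _ ≤ (1 - δ + δ ^ 2 / (2 * δ)) * x + 19 * τ / δ := by
      gcongr
      nlinarith [mul_nonneg (sub_nonneg.2 hδ_le) (sq_nonneg δ)]
    _ = (1 - δ / 2) * x + 19 * τ / δ := by
      field_simp
      ring

lemma le_of_affine_recursion {y : ℕ → ℝ} {δ B : ℝ} (hδ : 0 < δ) (hδ_le : δ ≤ 1)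
    (h : ∀ i, y (i + 1) ≤ (1 - δ) * y i + B) (i : ℕ) :
    y i ≤ (1 - δ) ^ i * (y 0 - B / δ) + B / δ := by
  induction i with
  | zero => simp only [pow_zero, one_mul, sub_add_cancel, le_refl]
  | succ i ih =>
    have fixed_point : (1 - δ) * (B / δ) + B = B / δ := by
      field_simp
      ring
    calc y (i + 1) ≤ (1 - δ) * y i + B := h i
      _ ≤ (1 - δ) * ((1 - δ) ^ i * (y 0 - B / δ) + B / δ) + B := by
        gcongr
      _ = (1 - δ) ^ (i + 1) * (y 0 - B / δ) + B / δ := by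
        rw [mul_add, add_assoc, fixed_point, ← mul_assoc, pow_succ']

open Topology in
lemma limsup_ofReal_le_of_affine_recursion {y : ℕ → ℝ} {δ B : ℝ} (hδ : 0 < δ) (hδ_le : δ ≤ 1)
    (h : ∀ i, y (i + 1) ≤ (1 - δ) * y i + B) :
    limsup (fun i => ENNReal.ofReal (y i)) atTop ≤ ENNReal.ofReal (B / δ) := by
  have geometric : Tendsto (fun i : ℕ => (1 - δ) ^ i) atTop (𝓝 0) :=
    tendsto_pow_atTop_nhds_zero_of_lt_one (sub_nonneg.2 hδ_le) (sub_lt_self 1 hδ)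
  have bound := ENNReal.tendsto_ofReal ((geometric.mul_const (y 0 - B / δ)).add_const (B / δ))
  rw [zero_mul, zero_add] at bound
  rw [← bound.limsup_eq]
  exact limsup_le_limsup (.of_forall fun i =>
    ENNReal.ofReal_le_ofReal (le_of_affine_recursion hδ hδ_le h i))

lemma limsup_lintegral_enorm_pow_four_le [IsFiniteMeasure P] {ℱ : Filtration ℕ mΩ}
    {X Y n : ℕ → Ω → E} {δ s τ : ℝ} (hδ : 0 < δ) (hδ_le : δ ≤ 1) (hs : 38 * s ≤ δ ^ 2)
    (hX : ∀ i, MemLp (X i) 4 P) (hX_succ : ∀ i, X (i + 1) = Y i + n i)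
    (hYm : ∀ i, StronglyMeasurable[ℱ i] (Y i)) (hn : ∀ i, MemLp (n i) 4 P)
    (hYX : ∀ i ω, ‖Y i ω‖ ^ 2 ≤ (1 - δ) * ‖X i ω‖ ^ 2) (hn_zero : ∀ i, P[n i | ℱ i] =ᵐ[P] 0)
    (hnX : ∀ i, ∫ ω, ‖n i ω‖ ^ 4 ∂P ≤ s * ∫ ω, ‖X i ω‖ ^ 4 ∂P + τ) :
    limsup (fun i => ∫⁻ ω, ‖X i ω‖ₑ ^ 4 ∂P) atTop ≤ ENNReal.ofReal (38 * τ / δ ^ 2) := by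
  have recursion (i : ℕ) : ∫ ω, ‖X (i + 1) ω‖ ^ 4 ∂P ≤
      (1 - δ / 2) * ∫ ω, ‖X i ω‖ ^ 4 ∂P + 19 * τ / δ := by
    rw [hX_succ]
    exact integral_norm_add_pow_four_le_of_contracting (ℱ.le i) hδ hδ_le hs (hX i) (hYm i) (hn i)
      (hYX i) (hn_zero i) (hnX i)
  have limsup_le := limsup_ofReal_le_of_affine_recursion
    (y := fun i => ∫ ω, ‖X i ω‖ ^ 4 ∂P) (half_pos hδ) (by linarith) recursion
  simp only [ofReal_integral_norm_pow_four (hX _)] at limsup_le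
  convert limsup_le using 2
  field_simp
  ring

end FourthMoment

section ErrorRecursion

variable {N M G : ℕ} {Ω : Type*} {mΩ : MeasurableSpace Ω} {P : Measure Ω}
  {ℱ : Filtration ℕ mΩ} {grp : Fin N → Fin G} {A : Matrix (Fin N) (Fin N) ℝ}
  {J : Fin N → Vec M → ℝ} {wo : NetVec N M} {lam : Fin N → ℝ} {L : ℝ}
  {gHat : ℕ → Ω → Fin N → Vec M → Vec M} {α σ : ℝ}

lemma atcStep_eq_combine (μ : Fin N → ℝ) (g : Fin N → Vec M → Vec M) (W : NetVec N M) :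
    atcStep A μ g W = combine A (W - scale μ (netGrad J W + gradNoise J g W)) := by
  ext k : 1
  simp only [combine_apply, PiLp.sub_apply, scale_apply, gradNoise, add_sub_cancel]
  rfl

lemma iterate_succ (J : Fin N → Vec M → ℝ) (μ : Fin N → ℝ) (i : ℕ) :
    iterate A μ gHat (i + 1) = fun ω => combine A (iterate A μ gHat i ω -
      scale μ (netGrad J (iterate A μ gHat i ω) +
        gradNoise J (gHat i ω) (iterate A μ gHat i ω))) :=
  funext fun ω => atcStep_eq_combine μ (gHat i ω) (iterate A μ gHat i ω)

lemma IsIrreduciblePolicy.combine_eq_self (hA : IsIrreduciblePolicy grp A) {x : NetVec N M}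
    (hx : ∀ l k, grp l = grp k → x l = x k) : combine A x = x := by
  ext k : 1
  have replace_term (l : Fin N) : A l k • x l = A l k • x k := by
    by_cases h : grp l = grp k
    · rw [hx l k h]
    · rw [hA.off_group l k h, zero_smul, zero_smul]
  rw [combine_apply, Finset.sum_congr rfl fun l _ => replace_term l, ← Finset.sum_smul,
    sum_col_of_mem_colStochastic hA.mem_colStochastic, one_smul]

lemma netError_succ (hA : IsIrreduciblePolicy grp A) (hJ : HasRegularGradients grp J wo lam L)
    (μ : Fin N → ℝ) (i : ℕ) (ω : Ω) :
    netError A μ gHat wo (i + 1) ω = exactStepError A μ J wo (iterate A μ gHat i ω) +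
      combine A (scale μ (gradNoise J (gHat i ω) (iterate A μ gHat i ω))) := by
  simp only [netError, iterate_succ J, exactStepError, map_add, map_sub,
    hA.combine_eq_self hJ.common_center]
  abel

namespace HasRegularGradients

variable (hJ : HasRegularGradients grp J wo lam L)

include hJ

lemma continuous_netGrad : Continuous (netGrad J) := by
  have := hJ.continuous_gradient
  unfold netGrad
  fun_prop

lemma norm_netGrad_le (W : NetVec N M) : ‖netGrad J W‖ ≤ |L| * ‖wo - W‖ := by
  rw [← sq_le_sq₀ (norm_nonneg _) (by positivity), mul_pow, sq_abs, PiLp.norm_sq_eq_of_L2,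
    PiLp.norm_sq_eq_of_L2, Finset.mul_sum]
  gcongr with k
  rw [← mul_pow]
  exact pow_le_pow_left₀ (norm_nonneg _) (hJ.norm_gradient_le k (W k)) 2

lemma memLp_netGrad [IsFiniteMeasure P] {W : Ω → NetVec N M} (hW : MemLp W 4 P) :
    MemLp (fun ω => netGrad J (W ω)) 4 P :=
  ((memLp_const wo).sub hW).of_le_mul (hJ.continuous_netGrad.comp_aestronglyMeasurable hW.1)
    (ae_of_all _ fun ω => hJ.norm_netGrad_le (W ω))

lemma continuous_exactStepError (A : Matrix (Fin N) (Fin N) ℝ) (μ : Fin N → ℝ) :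
    Continuous (exactStepError A μ J wo) :=
  (combine A).continuous.comp
    ((continuous_const.sub continuous_id).add ((scale μ).continuous.comp hJ.continuous_netGrad))

end HasRegularGradients

namespace IsGradientNoise

variable (hnoise : IsGradientNoise P ℱ J wo gHat α σ)

include hnoise

lemma memLp_gradNoise (i : ℕ) {W : Ω → NetVec N M} (hWm : StronglyMeasurable[ℱ i] W)
    (hW : MemLp W 4 P) : MemLp (fun ω => gradNoise J (gHat i ω) (W ω)) 4 P :=
  memLp_four_of_integrable ((hnoise.adapted i W hWm hW).mono (ℱ.le _)).aestronglyMeasurable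
    (hnoise.integrable i W hWm hW)

lemma integral_norm_gradNoise_pow_four_le [IsProbabilityMeasure P] (i : ℕ) {W : Ω → NetVec N M}
    (hWm : StronglyMeasurable[ℱ i] W) (hW : MemLp W 4 P) :
    ∫ ω, ‖gradNoise J (gHat i ω) (W ω)‖ ^ 4 ∂P ≤
      α ^ 2 * ∫ ω, ‖wo - W ω‖ ^ 4 ∂P + σ ^ 4 := by
  have error := (integrable_norm_pow_four ((memLp_const wo).sub hW)).const_mul (α ^ 2)
  rw [← integral_condExp (ℱ.le i)]
  refine (integral_mono_ae integrable_condExp (error.add (integrable_const (σ ^ 4)))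
    (hnoise.fourthMoment i W hWm hW)).trans_eq ?_
  rw [integral_add' error (integrable_const _), integral_const, probReal_univ, one_smul]
  exact congrArg (· + σ ^ 4) (integral_const_mul _ _)

lemma condExp_clm_gradNoise_eq_zero [IsFiniteMeasure P] (T : NetVec N M →L[ℝ] NetVec N M) (i : ℕ)
    {W : Ω → NetVec N M} (hWm : StronglyMeasurable[ℱ i] W) (hW : MemLp W 4 P) :
    P[fun ω => T (gradNoise J (gHat i ω) (W ω)) | ℱ i] =ᵐ[P] 0 := by
  have noise_integrable := (hnoise.memLp_gradNoise i hWm hW).integrable (by norm_num)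
  refine (T.comp_condExp_comm noise_integrable).symm.trans ?_
  filter_upwards [hnoise.martingaleDifference i W hWm hW] with ω hω
  rw [Function.comp_apply, hω]
  exact map_zero T

lemma stronglyMeasurable_and_memLp_iterate [IsFiniteMeasure P]
    (hJ : HasRegularGradients grp J wo lam L) (A : Matrix (Fin N) (Fin N) ℝ) (μ : Fin N → ℝ)
    (i : ℕ) : StronglyMeasurable[ℱ i] (iterate A μ gHat i) ∧ MemLp (iterate A μ gHat i) 4 P := by
  induction i with
  | zero => exact ⟨stronglyMeasurable_const, memLp_const 0⟩
  | succ i ih =>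
    obtain ⟨hWm, hW⟩ := ih
    have hWm' := hWm.mono (ℱ.mono i.le_succ)
    have gradient_measurable := (hJ.continuous_netGrad.comp_stronglyMeasurable hWm').add
      (hnoise.adapted i _ hWm hW)
    have gradient_memLp := (hJ.memLp_netGrad hW).add (hnoise.memLp_gradNoise i hWm hW)
    have step_measurable := (combine A).continuous.comp_stronglyMeasurable
      (hWm'.sub ((scale μ).continuous.comp_stronglyMeasurable gradient_measurable))
    have step_memLp := (combine A).comp_memLp' (hW.sub ((scale μ).comp_memLp' gradient_memLp))
    rw [iterate_succ J]
    exact ⟨step_measurable, step_memLp⟩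

lemma memLp_netError [IsFiniteMeasure P] (hJ : HasRegularGradients grp J wo lam L)
    (A : Matrix (Fin N) (Fin N) ℝ) (μ : Fin N → ℝ) (i : ℕ) :
    MemLp (netError A μ gHat wo i) 4 P :=
  (memLp_const wo).sub (hnoise.stronglyMeasurable_and_memLp_iterate hJ A μ i).2

lemma integral_norm_clm_gradNoise_pow_four_le [IsProbabilityMeasure P]
    {T S : NetVec N M →L[ℝ] NetVec N M} {β : ℝ} (hT : ∀ x, ‖T x‖ ≤ β * ‖x‖) (hS : ∀ x, ‖x‖ ≤ ‖S x‖)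
    (i : ℕ) {W : Ω → NetVec N M} (hWm : StronglyMeasurable[ℱ i] W) (hW : MemLp W 4 P) :
    ∫ ω, ‖T (gradNoise J (gHat i ω) (W ω))‖ ^ 4 ∂P ≤
      β ^ 4 * α ^ 2 * ∫ ω, ‖S (wo - W ω)‖ ^ 4 ∂P + β ^ 4 * σ ^ 4 := by
  have noise := hnoise.memLp_gradNoise i hWm hW
  have error : MemLp (fun ω => wo - W ω) 4 P := (memLp_const wo).sub hW
  have error_le : ∫ ω, ‖wo - W ω‖ ^ 4 ∂P ≤ ∫ ω, ‖S (wo - W ω)‖ ^ 4 ∂P :=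
    integral_mono (integrable_norm_pow_four error)
      (integrable_norm_pow_four (S.comp_memLp' error))
      fun ω => pow_le_pow_left₀ (norm_nonneg _) (hS _) 4
  calc ∫ ω, ‖T (gradNoise J (gHat i ω) (W ω))‖ ^ 4 ∂P
      ≤ ∫ ω, β ^ 4 * ‖gradNoise J (gHat i ω) (W ω)‖ ^ 4 ∂P :=
        integral_mono (integrable_norm_pow_four (T.comp_memLp' noise))
          ((integrable_norm_pow_four noise).const_mul _)
          fun ω => (pow_le_pow_left₀ (norm_nonneg _) (hT _) 4).trans_eq (mul_pow _ _ 4)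
    _ = β ^ 4 * ∫ ω, ‖gradNoise J (gHat i ω) (W ω)‖ ^ 4 ∂P := integral_const_mul _ _
    _ ≤ β ^ 4 * (α ^ 2 * ∫ ω, ‖S (wo - W ω)‖ ^ 4 ∂P + σ ^ 4) := by
      gcongr
      exact (hnoise.integral_norm_gradNoise_pow_four_le i hWm hW).trans (by gcongr)
    _ = β ^ 4 * α ^ 2 * ∫ ω, ‖S (wo - W ω)‖ ^ 4 ∂P + β ^ 4 * σ ^ 4 := by ring

lemma limsup_lintegral_enorm_netError_pow_four_le [IsProbabilityMeasure P]
    (hA : IsIrreduciblePolicy grp A) (hJ : HasRegularGradients grp J wo lam L) {μ : Fin N → ℝ}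
    {S : NetVec N M →L[ℝ] NetVec N M} {δ β : ℝ} (hδ : 0 < δ) (hδ_le : δ ≤ 1)
    (hβ : 38 * (β ^ 4 * α ^ 2) ≤ δ ^ 2) (hS : ∀ x, ‖x‖ ≤ ‖S x‖)
    (hstep : ∀ W, ‖S (exactStepError A μ J wo W)‖ ^ 2 ≤ (1 - δ) * ‖S (wo - W)‖ ^ 2)
    (hgain : ∀ x, ‖S (combine A (scale μ x))‖ ≤ β * ‖x‖) :
    limsup (fun i => ∫⁻ ω, ‖netError A μ gHat wo i ω‖ₑ ^ 4 ∂P) atTop ≤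
      ENNReal.ofReal (38 * (β ^ 4 * σ ^ 4) / δ ^ 2) := by
  have iter := hnoise.stronglyMeasurable_and_memLp_iterate hJ A μ
  let T : NetVec N M →L[ℝ] NetVec N M := S ∘L combine A ∘L scale μ
  let W := iterate A μ gHat
  let X (i : ℕ) (ω : Ω) : NetVec N M := S (netError A μ gHat wo i ω)
  let Y (i : ℕ) (ω : Ω) : NetVec N M := S (exactStepError A μ J wo (W i ω))
  let n (i : ℕ) (ω : Ω) : NetVec N M := T (gradNoise J (gHat i ω) (W i ω))
  have X_memLp (i : ℕ) : MemLp (X i) 4 P := S.comp_memLp' (hnoise.memLp_netError hJ A μ i)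
  have X_succ (i : ℕ) : X (i + 1) = Y i + n i := funext fun ω =>
    (congrArg S (netError_succ hA hJ μ i ω)).trans (map_add S _ _)
  have Y_measurable (i : ℕ) : StronglyMeasurable[ℱ i] (Y i) :=
    S.continuous.comp_stronglyMeasurable
      ((hJ.continuous_exactStepError A μ).comp_stronglyMeasurable (iter i).1)
  have n_memLp (i : ℕ) : MemLp (n i) 4 P :=
    T.comp_memLp' (hnoise.memLp_gradNoise i (iter i).1 (iter i).2)
  have n_condExp (i : ℕ) : P[n i | ℱ i] =ᵐ[P] 0 :=
    hnoise.condExp_clm_gradNoise_eq_zero T i (iter i).1 (iter i).2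
  have n_moment (i : ℕ) : ∫ ω, ‖n i ω‖ ^ 4 ∂P ≤
      β ^ 4 * α ^ 2 * ∫ ω, ‖X i ω‖ ^ 4 ∂P + β ^ 4 * σ ^ 4 :=
    hnoise.integral_norm_clm_gradNoise_pow_four_le (T := T) hgain hS i (iter i).1 (iter i).2
  have weighted := limsup_lintegral_enorm_pow_four_le hδ hδ_le hβ X_memLp X_succ Y_measurable
    n_memLp (fun i ω => hstep (W i ω)) n_condExp n_moment
  refine (limsup_le_limsup (.of_forall fun i => lintegral_mono fun ω => ?_)).trans weighted
  gcongr
  exact enorm_le_iff_norm_le.2 (hS _)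

open Topology in
lemma exists_eventually_limsup_netError_pow_four_le [IsProbabilityMeasure P]
    (hA : IsIrreduciblePolicy grp A) (hJ : HasRegularGradients grp J wo lam L) {ρ : ℝ}
    (hρ : 0 < ρ) :
    ∃ C : ℝ, 0 ≤ C ∧ ∀ᶠ u in 𝓝[>] (0 : ℝ), ∀ μ : Fin N → ℝ, (∀ k, ρ * u ≤ μ k) →
      (∀ k, μ k ≤ u) → limsup (fun i => ∫⁻ ω, ‖netError A μ gHat wo i ω‖ₑ ^ 4 ∂P) atTop ≤
        ENNReal.ofReal (C * u ^ 2) := by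
  obtain ⟨κ, b, hκ, contraction⟩ := exists_eventually_norm_scale_exactStepError_le hA hJ hρ
  set K := |b| * ‖combine (E := Vec M) A‖
  have rate_small : ∀ᶠ u in 𝓝 (0 : ℝ), κ * u < 1 :=
    (Continuous.tendsto' (by fun_prop) 0 0 (mul_zero κ)).eventually_lt_const one_pos
  have noise_small : ∀ᶠ u in 𝓝 (0 : ℝ), 38 * (K ^ 4 * α ^ 2) * u ^ 2 < κ ^ 2 :=
    (Continuous.tendsto' (by fun_prop) 0 0 (by ring)).eventually_lt_const (by positivity)
  refine ⟨38 * (K ^ 4 * σ ^ 4) / κ ^ 2, by positivity, ?_⟩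
  filter_upwards [self_mem_nhdsWithin, contraction, nhdsWithin_le_nhds rate_small,
    nhdsWithin_le_nhds noise_small] with u (hu : 0 < u) ⟨t, one_le_t, t_le, hstep⟩ hκu hKu μ hρμ hμu
  have hμ (k : Fin N) : |μ k| ≤ u := by
    rw [abs_of_nonneg ((mul_pos hρ hu).le.trans (hρμ k))]
    exact hμu k
  have gain (x : NetVec N M) : ‖scale t (combine A (scale μ x))‖ ≤ K * u * ‖x‖ :=
    calc ‖scale t (combine A (scale μ x))‖ ≤ |b| * ‖combine A (scale μ x)‖ :=
        norm_scale_le (abs_nonneg b) (fun k => (t_le k).trans (le_abs_self b)) _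
      _ ≤ |b| * (‖combine (E := Vec M) A‖ * (u * ‖x‖)) := by
        gcongr
        exact (combine A).le_opNorm_of_le (norm_scale_le hu.le hμ x)
      _ = K * u * ‖x‖ := by ring
  have small : 38 * ((K * u) ^ 4 * α ^ 2) ≤ (κ * u) ^ 2 :=
    calc 38 * ((K * u) ^ 4 * α ^ 2) = 38 * (K ^ 4 * α ^ 2) * u ^ 2 * u ^ 2 := by ring
      _ ≤ κ ^ 2 * u ^ 2 := by gcongr
      _ = (κ * u) ^ 2 := (mul_pow κ u 2).symm
  convert hnoise.limsup_lintegral_enorm_netError_pow_four_le hA hJ (mul_pos hκ hu) hκu.le small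
    (norm_le_norm_scale one_le_t) (hstep μ hρμ hμu) gain using 2
  field_simp

end IsGradientNoise

end ErrorRecursion

end DiffusionNetwork

open DiffusionNetwork in
theorem mainTheorem2_general {N M G : ℕ} {Ω : Type*} {mΩ : MeasurableSpace Ω} (P : Measure Ω)
    [IsProbabilityMeasure P] (ℱ : Filtration ℕ mΩ) (grp : Fin N → Fin G)
    (A : Matrix (Fin N) (Fin N) ℝ) (J : Fin N → Vec M → ℝ) (wo : NetVec N M) (lam : Fin N → ℝ)
    (L : ℝ) (gHat : ℕ → Ω → Fin N → Vec M → Vec M) (α σ : ℝ) (hA : IsIrreduciblePolicy grp A)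
    (hJ : HasRegularGradients grp J wo lam L) (hnoise : IsGradientNoise P ℱ J wo gHat α σ) :
    ∀ ρ : ℝ, 0 < ρ → ∃ μ₀ C : ℝ, 0 < μ₀ ∧ 0 ≤ C ∧
      ∀ μ : Fin N → ℝ, (∀ k, 0 < μ k) → (∀ k, ρ * muMax μ ≤ μ k) → muMax μ ≤ μ₀ →
        limsup (fun i : ℕ => ∫⁻ ω, ‖netError A μ gHat wo i ω‖ₑ ^ 2 ∂P) atTop
            ≤ ENNReal.ofReal (C * muMax μ) ∧
        limsup (fun i : ℕ => ∫⁻ ω, ‖netError A μ gHat wo i ω‖ₑ ^ 4 ∂P) atTop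
            ≤ ENNReal.ofReal (C * muMax μ ^ 2) := by
  intro ρ hρ
  rcases isEmpty_or_nonempty (Fin N) with _ | _
  · refine ⟨1, 0, one_pos, le_rfl, fun μ _ _ _ => ?_⟩
    simp [Subsingleton.elim (netError A μ gHat wo _ _) 0]
  obtain ⟨C, hC, fourth_moment⟩ := hnoise.exists_eventually_limsup_netError_pow_four_le hA hJ hρ
  obtain ⟨μ₀, hμ₀, hC_le⟩ := mem_nhdsGT_iff_exists_Ioc_subset.1 fourth_moment
  refine ⟨μ₀, 1 + C, hμ₀, by positivity, fun μ hμ hρμ hμ_le => ?_⟩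
  have le_muMax (k : Fin N) : μ k ≤ muMax μ := le_ciSup (Set.finite_range μ).bddAbove k
  have muMax_pos : 0 < muMax μ := (hμ (Classical.arbitrary _)).trans_le (le_muMax _)
  have fourth := hC_le ⟨muMax_pos, hμ_le⟩ μ hρμ le_muMax
  constructor
  · refine limsup_lintegral_enorm_sq_le (fun i => (hnoise.memLp_netError hJ A μ i).1)
      (fourth.trans ?_)
    rw [← ENNReal.ofReal_pow (by positivity)]
    exact ENNReal.ofReal_le_ofReal (by nlinarith [mul_pos muMax_pos muMax_pos, mul_nonneg hC hC])
  · exact fourth.trans (ENNReal.ofReal_le_ofReal (by gcongr; linarith))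

theorem mainTheorem2 {N M G : ℕ} {Ω : Type*} {mΩ : MeasurableSpace Ω}
    (P : Measure Ω) [IsProbabilityMeasure P] (ℱ : Filtration ℕ mΩ)
    (grp : Fin N → Fin G) (A : Matrix (Fin N) (Fin N) ℝ)
    (J : Fin N → DiffusionNetwork.Vec M → ℝ) (wo : DiffusionNetwork.NetVec N M)
    (lamL lamU : Fin N → ℝ)
    (gHat : ℕ → Ω → Fin N → DiffusionNetwork.Vec M → DiffusionNetwork.Vec M) (α σ : ℝ)
    (hA : DiffusionNetwork.IsCombinationPolicy grp A)
    (hJ : DiffusionNetwork.IsCostFamily grp J wo lamL lamU)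
    (hα : 0 ≤ α) (hσ : 0 ≤ σ)
    (hnoise : DiffusionNetwork.IsGradientNoise P ℱ J wo gHat α σ) :
    ∀ ρ : ℝ, 0 < ρ → ∃ μ₀ C : ℝ, 0 < μ₀ ∧ 0 ≤ C ∧
      ∀ μ : Fin N → ℝ, (∀ k, 0 < μ k) → (∀ k, ρ * DiffusionNetwork.muMax μ ≤ μ k) →
        DiffusionNetwork.muMax μ ≤ μ₀ →
        limsup (fun i : ℕ => ∫⁻ ω, ‖DiffusionNetwork.netError A μ gHat wo i ω‖ₑ ^ 2 ∂P) atTop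
            ≤ ENNReal.ofReal (C * DiffusionNetwork.muMax μ) ∧
        limsup (fun i : ℕ => ∫⁻ ω, ‖DiffusionNetwork.netError A μ gHat wo i ω‖ₑ ^ 4 ∂P) atTop
            ≤ ENNReal.ofReal (C * DiffusionNetwork.muMax μ ^ 2) := by
  obtain ⟨L, regular⟩ := hJ.exists_hasRegularGradients
  exact mainTheorem2_general P ℱ grp A J wo lamL L gHat α σ hA.isIrreduciblePolicy regular hnoise
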